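/- Let $\gamma>0$, $0<v_0\le V_0$, and let $g:[0,\infty)\to\mathbb R$ be nonincreasing and differentiable with bounded derivative and $v_0\le -g\le V_0$. Let $C$ be the space of bounded continuous functions on $\mathbb R$ with the sup norm $\|\cdot\|$. For $u_0\in C$ with $u_0\ge 0$ consider the free boundary problem $$u_t=u_{xx}-\gamma u\quad (x\ne s(t),\ t>0),\qquad u(x,0)=u_0(x),$$ $$g(u(s(t),t))=v(t),\qquad u_x^+(s(t),t)-u_x^-(s(t),t)=v(t)\quad (t>0),\qquad s(t)=\int_0^t v(\tau)\,d\tau,$$ where $u_x^\pm(s(t),t)$ are the right and left $x$-derivatives at the interface. A classical solution is a pair $(u,v)$ satisfying these equations such that $u$ and $v$ are continuous for $t\ge 0$, $u_{xx}$ and $u_t$ exist and are continuous for $x\ne s(t)$, $t>0$, $u$ is bounded on $\mathbb R\times[0,T]$ for every $T<\infty$, and $u(s(t),t)\ge 0$ for $t>0$. The evolution $T(t)$ is the one defined by classical solutions in the moving coordinate $x'=x-s(t)$, i.e. $(T(t)u_0)(x')=u(x'+s(t),t)$; for $B\subset C$, $T(t)B$ is the set of all such states at time $t$ of classical solutions with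 initial data in $B$. Its initial-data part is $T_2(0)u_0=u_0$ and, for $t>0$, $$(T_2(t)u_0)(x')=e^{-\gamma t}\int_{-\infty}^{\infty}\frac{1}{\sqrt{4\pi t}}\exp\Big(-\frac{(x'+s(t)-\xi)^2}{4t}\Big)u_0(\xi)\,d\xi ,$$ where $s$ is the interface of a classical solution with initial data $u_0$. Then: (i) for every $N$, every $t\ge0$ and every initial datum $u_0$ in the ball $\{u\in C:\|u\|\le N\}$, and every classical solution with initial data $u_0$, one has $T_2(t)u_0\in C$ and $\|T_2(t)u_0\|\le e^{-\gamma t}N$; (ii) for every $\varepsilon>0$ the ball $B_{abs}=\{w\in C:\|w\|\le V_0/(2\sqrt\gamma)+\varepsilon\}$ absorbs all bounded sets under $T$: for every bounded $B\subset C$ there is $t_B\ge0$ with $T(t)B\subset B_{abs}$ for all $t\ge t_B$. -/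

import Mathlib

open scoped BoundedContinuousFunction
open MeasureTheory

namespace StefanKinetics

/-- Standing assumptions on the kinetic function `g`, regarded as a function on `[0, ∞)`: it is
nonincreasing and differentiable with bounded derivative, and `-g` takes its values in
`[v₀, V₀]` with `v₀ > 0`. Values of `g` at negative arguments play no role. -/
structure IsKinetic (g : ℝ → ℝ) (v₀ V₀ : ℝ) : Prop where
  v₀_pos : 0 < v₀
  antitone : AntitoneOn g (Set.Ici 0)
  differentiable : DifferentiableOn ℝ g (Set.Ici 0)
  deriv_bounded : ∃ C : ℝ, ∀ y, 0 ≤ y → |derivWithin g (Set.Ici 0) y| ≤ C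
  lower : ∀ y, 0 ≤ y → v₀ ≤ -g y
  upper : ∀ y, 0 ≤ y → -g y ≤ V₀

/-- Position `s(t) = ∫₀ᵗ v(τ) dτ` of the interface moving with velocity `v`. -/
noncomputable def front (v : ℝ → ℝ) (t : ℝ) : ℝ := ∫ τ in (0 : ℝ)..t, v τ

/-- The set of points `(x, t)` with `t > 0` that lie off the interface. -/
def offFront (v : ℝ → ℝ) : Set (ℝ × ℝ) := {p | 0 < p.2 ∧ p.1 ≠ front v p.2}

/-- `(u, v)` is a classical solution, for `t ≥ 0`, of the free boundary problem
`u_t = u_xx - γ u` for `x ≠ s(t)`, `u(x, 0) = u₀(x) ≥ 0`, `g(u(s(t), t)) = v(t)`,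
`u_x⁺(s(t), t) - u_x⁻(s(t), t) = v(t)`. -/
structure IsClassicalSolution (g : ℝ → ℝ) (γ : ℝ) (u₀ : ℝ → ℝ) (u : ℝ → ℝ → ℝ) (v : ℝ → ℝ) :
    Prop where
  continuousOn_u : ContinuousOn (fun p : ℝ × ℝ => u p.1 p.2) {p | 0 ≤ p.2}
  continuousOn_v : ContinuousOn v (Set.Ici 0)
  /-- Boundedness on finite time intervals: the class in which the problem is posed
  (without a growth restriction already the heat equation has nonunique solutions). -/
  bounded : ∀ T : ℝ, ∃ K : ℝ, ∀ x t, 0 ≤ t → t ≤ T → |u x t| ≤ K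
  differentiableAt_x : ∀ p ∈ offFront v, DifferentiableAt ℝ (fun y => u y p.2) p.1
  differentiableAt_xx : ∀ p ∈ offFront v, DifferentiableAt ℝ (deriv fun y => u y p.2) p.1
  differentiableAt_t : ∀ p ∈ offFront v, DifferentiableAt ℝ (u p.1) p.2
  continuousOn_xx :
    ContinuousOn (fun p : ℝ × ℝ => deriv (deriv fun y => u y p.2) p.1) (offFront v)
  continuousOn_t : ContinuousOn (fun p : ℝ × ℝ => deriv (u p.1) p.2) (offFront v)
  heat : ∀ p ∈ offFront v,
    deriv (u p.1) p.2 = deriv (deriv fun y => u y p.2) p.1 - γ * u p.1 p.2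
  initial : ∀ x, u x 0 = u₀ x
  initial_nonneg : ∀ x, 0 ≤ u₀ x
  /-- The interface temperature stays in the domain `[0, ∞)` of the kinetic function. -/
  front_nonneg : ∀ t, 0 < t → 0 ≤ u (front v t) t
  kinetic : ∀ t, 0 < t → g (u (front v t) t) = v t
  /-- The Stefan condition; `a` and `b` are the right and left derivatives at the interface. -/
  jump : ∀ t, 0 < t → ∃ a b : ℝ,
    HasDerivWithinAt (fun x => u x t) a (Set.Ici (front v t)) (front v t) ∧
    HasDerivWithinAt (fun x => u x t) b (Set.Iic (front v t)) (front v t) ∧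
    a - b = v t

/-- `w = T(t) u₀`: `w` is the state at time `t`, in the moving coordinate `x' = x - s(t)`, of a
classical solution that starts from `u₀`. -/
def IsState (g : ℝ → ℝ) (γ t : ℝ) (u₀ w : ℝ →ᵇ ℝ) : Prop :=
  ∃ u v, IsClassicalSolution g γ u₀ u v ∧ ∀ x, w x = u (x + front v t) t

/-- The states of a classical solution are bounded continuous functions. -/
theorem IsClassicalSolution.exists_isState {g : ℝ → ℝ} {γ : ℝ} {u₀ : ℝ →ᵇ ℝ} {u : ℝ → ℝ → ℝ}
    {v : ℝ → ℝ} (h : IsClassicalSolution g γ u₀ u v) {t : ℝ} (ht : 0 ≤ t) :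
    ∃ w : ℝ →ᵇ ℝ, IsState g γ t u₀ w ∧ ∀ x, w x = u (x + front v t) t := by
  obtain ⟨K, hK⟩ := h.bounded t
  have hc : Continuous fun x : ℝ => u (x + front v t) t :=
    h.continuousOn_u.comp_continuous (f := fun x : ℝ => (x + front v t, t))
      (by fun_prop) (fun _ => ht)
  let w := BoundedContinuousFunction.ofNormedAddCommGroup (fun x : ℝ => u (x + front v t) t)
    hc K (fun x => hK _ _ ht le_rfl)
  exact ⟨w, ⟨u, v, h, fun _ => rfl⟩, fun _ => rfl⟩

/-- The image `T(t) B` of a set of initial data under the evolution. -/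
def evolve (g : ℝ → ℝ) (γ t : ℝ) (B : Set (ℝ →ᵇ ℝ)) : Set (ℝ →ᵇ ℝ) :=
  {w | ∃ u₀ ∈ B, IsState g γ t u₀ w}

/-- `A` absorbs every bounded set under the evolution `T`. -/
def IsAbsorbing (g : ℝ → ℝ) (γ : ℝ) (A : Set (ℝ →ᵇ ℝ)) : Prop :=
  ∀ B : Set (ℝ →ᵇ ℝ), Bornology.IsBounded B →
    ∃ t₀ : ℝ, 0 ≤ t₀ ∧ ∀ t, t₀ ≤ t → evolve g γ t B ⊆ A

/-- The heat kernel `G(x, t, ξ, τ)`, for `τ < t`. -/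
noncomputable def heatKernel (x t ξ τ : ℝ) : ℝ :=
  Real.exp (-(x - ξ) ^ 2 / (4 * (t - τ))) / Real.sqrt (4 * Real.pi * (t - τ))

/-- The initial-data part `T₂(t) u₀` of the evolution, in the moving coordinate of the interface
with velocity `v`; at `t = 0`, where the kernel is a point mass, it is `u₀`. -/
noncomputable def initialPart (γ : ℝ) (v : ℝ → ℝ) (t : ℝ) (u₀ : ℝ → ℝ) (x : ℝ) : ℝ :=
  if t = 0 then u₀ x
  else Real.exp (-γ * t) * ∫ ξ : ℝ, heatKernel (x + front v t) t ξ 0 * u₀ ξ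

end StefanKinetics

namespace StefanKinetics

open Set Filter Topology

/-! Part (i) holds because convolution with a Gaussian of mass one does not increase the sup norm.

For (ii), the kinetic condition gives `-V₀ ≤ v ≤ 0` whatever the solution is, so the interface is a
heat source of strength at most `V₀`. Its damped potential is at most `V₀ ∫ exp (-γ σ) / √(4πσ) dσ =
V₀ / (2√γ)`, integrated over `σ > 0`, while the initial data contribute at most `N exp (-γ t)`.

No representation formula for `u` is used; the bound comes from comparison
(`nonpos_of_subsolution`). To avoid jump relations for singular potentials, the source is smeared to
a Gaussian of width `h` (`layer`), and the lost jump of the derivative is restored by a multiple of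
an explicit function of size `√h` (`kink`). The sum is a supersolution with a concave kink stronger
than that of `u`, so the difference cannot have a positive maximum on the interface. This is
`le_barrier`; `h → 0` gives `le_add`. With `u ≥ 0`, again by comparison, it becomes a bound on the
norm. -/

/-! ### Maximum principle across a moving interface -/

/-- The right derivative at a point where `f` is maximal from the right is nonpositive. -/
theorem rightDeriv_nonpos {f : ℝ → ℝ} {x a : ℝ} (hf : HasDerivWithinAt f a (Ici x) x)
    (hmax : ∀ᶠ y in 𝓝[>] x, f y ≤ f x) : a ≤ 0 := by
  rw [← hasDerivWithinAt_Ioi_iff_Ici,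
    hasDerivWithinAt_iff_tendsto_slope' (by simp)] at hf
  refine le_of_tendsto hf ?_
  filter_upwards [hmax, self_mem_nhdsWithin] with y hy hxy
  rw [slope_def_field]
  exact div_nonpos_of_nonpos_of_nonneg (sub_nonpos.2 hy) (sub_nonneg.2 (le_of_lt hxy))

/-- The left derivative at a point where `f` is maximal from the left is nonnegative. -/
theorem leftDeriv_nonneg {f : ℝ → ℝ} {x b : ℝ} (hf : HasDerivWithinAt f b (Iic x) x)
    (hmax : ∀ᶠ y in 𝓝[<] x, f y ≤ f x) : 0 ≤ b := by
  rw [← hasDerivWithinAt_Iio_iff_Iic,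
    hasDerivWithinAt_iff_tendsto_slope' (by simp)] at hf
  refine ge_of_tendsto hf ?_
  filter_upwards [hmax, self_mem_nhdsWithin] with y hy hxy
  rw [slope_def_field]
  exact div_nonneg_of_nonpos (sub_nonpos.2 hy) (sub_nonpos.2 (le_of_lt hxy))

/-- The second derivative at a local maximum is nonpositive. -/
theorem secondDeriv_nonpos {f f' : ℝ → ℝ} {x d : ℝ} (hmax : IsLocalMax f x)
    (hf : ∀ᶠ y in 𝓝 x, HasDerivAt f (f' y) y) (hf' : HasDerivAt f' d x) : d ≤ 0 := by
  by_contra! hd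
  have e : deriv f =ᶠ[𝓝 x] f' := hf.mono fun y hy => hy.deriv
  have h2 : deriv (deriv f) x = d := by rw [e.deriv_eq, hf'.deriv]
  -- By the second derivative test the point is also a local minimum, so `f` is locally constant and
  -- `d = 0`.
  have hmin : IsLocalMin f x :=
    isLocalMin_of_deriv_deriv_pos (h2 ▸ hd) hmax.deriv_eq_zero hf.self_of_nhds.continuousAt
  have hconst : f =ᶠ[𝓝 x] fun _ => f x := by
    filter_upwards [hmax, hmin] with y h1 h2 using le_antisymm h1 h2
  have h0 : deriv (deriv f) x = 0 := by
    rw [(hconst.deriv).deriv_eq]; simp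
  linarith

/-- Weak maximum principle for functions that are subsolutions of the heat equation off a curve
`x = s t`, wherever they are positive, and have a convex kink on that curve. -/
theorem nonpos_of_subsolution {D : ℝ → ℝ → ℝ} {s : ℝ → ℝ} {T K : ℝ}
    (hc : ContinuousOn (fun p : ℝ × ℝ => D p.1 p.2) {p | 0 ≤ p.2})
    (hK : ∀ x t, 0 ≤ t → t ≤ T → D x t ≤ K) (h0 : ∀ x, D x 0 ≤ 0)
    (hoff : ∀ x t, 0 < t → x ≠ s t → 0 < D x t → ∃ (Dx : ℝ → ℝ) (Dt Dxx : ℝ),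
      (∀ᶠ y in 𝓝 x, HasDerivAt (fun y => D y t) (Dx y) y) ∧ HasDerivAt Dx Dxx x ∧
        HasDerivAt (D x) Dt t ∧ Dt ≤ Dxx)
    (hon : ∀ t, 0 < t → 0 < D (s t) t → ∃ a b : ℝ,
      HasDerivWithinAt (fun y => D y t) a (Ici (s t)) (s t) ∧
        HasDerivWithinAt (fun y => D y t) b (Iic (s t)) (s t) ∧ 0 < a - b)
    {x₁ t₁ : ℝ} (ht₁ : 0 ≤ t₁) (htT : t₁ ≤ T) : D x₁ t₁ ≤ 0 := by
  by_contra! hpos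
  set m := D x₁ t₁ with hm
  set q : ℝ := x₁ ^ 2 + 3 * t₁ + 1 with hq
  have hqpos : 0 < q := by positivity
  -- With this size the penalty `η * (x ^ 2 + 3 * t)` costs less than `m / 2` at `(x₁, t₁)`. The
  -- coefficient 3 exceeds the 2 produced by the second derivative of `x ^ 2`, which makes the final
  -- inequality strict.
  set η := m / (2 * q) with hη
  have hηpos : 0 < η := by positivity
  have hηq : η * q = m / 2 := by rw [hη]; field_simp
  have hKm : m ≤ K := hK _ _ ht₁ htT
  -- At `|x| = R` the penalty exceeds `K`, so a positive maximum of `E` lies strictly inside.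
  set R : ℝ := |x₁| + K / η + 1 with hR
  have hKpos : 0 < K := hpos.trans_le hKm
  have hKη : 0 < K / η := by positivity
  have hR1 : 1 < R := by have := abs_nonneg x₁; linarith
  have hRK : K < η * R ^ 2 := by
    have h1 : K / η < R := by have := abs_nonneg x₁; linarith
    have h2 : K < η * R := by rwa [div_lt_iff₀' hηpos] at h1
    nlinarith [mul_pos hηpos (by linarith : 0 < R)]
  have hx₁R : x₁ ∈ Icc (-R) R := abs_le.1 (by linarith)
  let E : ℝ → ℝ → ℝ := fun x t => D x t - η * (x ^ 2 + 3 * t)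
  have hEc : ContinuousOn (fun p : ℝ × ℝ => E p.1 p.2) (Icc (-R) R ×ˢ Icc 0 T) := by
    refine ContinuousOn.sub (hc.mono fun p hp => hp.2.1) ?_
    fun_prop
  obtain ⟨⟨x, t⟩, ⟨hx, ht⟩, hmax⟩ := (isCompact_Icc.prod isCompact_Icc).exists_isMaxOn
    ⟨(x₁, t₁), hx₁R, ht₁, htT⟩ hEc
  have hmax' : ∀ y τ, y ∈ Icc (-R) R → τ ∈ Icc 0 T → E y τ ≤ E x t :=
    fun y τ hy hτ => hmax (show (y, τ) ∈ Icc (-R) R ×ˢ Icc 0 T from ⟨hy, hτ⟩)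
  simp only at hx ht
  have hEpos : 0 < E x t := by
    refine lt_of_lt_of_le ?_ (hmax' x₁ t₁ hx₁R ⟨ht₁, htT⟩)
    change 0 < m - η * (x₁ ^ 2 + 3 * t₁)
    have : η * (x₁ ^ 2 + 3 * t₁) = m / 2 - η := by rw [← hηq, hq]; ring
    linarith
  have hDE : D x t = E x t + η * (x ^ 2 + 3 * t) := by simp [E]
  have hDpos : 0 < D x t := by
    rw [hDE]; have := ht.1; positivity
  have htpos : 0 < t := by
    rcases ht.1.eq_or_lt with h | h
    · rw [← h] at hDpos; linarith [h0 x]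
    · exact h
  have hxR : x ∈ Ioo (-R) R := by
    rw [mem_Ioo, ← abs_lt]
    by_contra! hge
    have h1 : R ^ 2 ≤ x ^ 2 := by rw [← sq_abs x]; gcongr
    have h2 := hK x t ht.1 ht.2
    have h3 : η * R ^ 2 ≤ η * (x ^ 2 + 3 * t) := by gcongr; linarith
    linarith
  have hlocx : IsLocalMax (fun y => E y t) x := by
    filter_upwards [Icc_mem_nhds hxR.1 hxR.2] with y hy using hmax' y t hy ht
  -- Only earlier times are compared, since the maximum may occur at `t = T`.
  have hloct : ∀ᶠ τ in 𝓝[<] t, E x τ ≤ E x t := by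
    filter_upwards [Ioo_mem_nhdsLT htpos] with τ hτ
    exact hmax' x τ hx ⟨hτ.1.le, hτ.2.le.trans ht.2⟩
  have hpen : ∀ y : ℝ, HasDerivAt (fun y : ℝ => η * (y ^ 2 + 3 * t)) (2 * η * y) y := fun y => by
    have := ((hasDerivAt_pow 2 y).add_const (3 * t)).const_mul η
    refine this.congr_deriv ?_
    push_cast
    ring
  by_cases hs : x = s t
  · subst hs
    obtain ⟨a, b, ha, hb, hab⟩ := hon t htpos hDpos
    have h1 := rightDeriv_nonpos (ha.sub (hpen (s t)).hasDerivWithinAt)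
      (hlocx.filter_mono nhdsWithin_le_nhds)
    have h2 := leftDeriv_nonneg (hb.sub (hpen (s t)).hasDerivWithinAt)
      (hlocx.filter_mono nhdsWithin_le_nhds)
    linarith
  · obtain ⟨Dx, Dt, Dxx, h1, h2, h3, h4⟩ := hoff x t htpos hs hDpos
    have e1 : Dxx - 2 * η ≤ 0 := by
      refine secondDeriv_nonpos hlocx (h1.mono fun y hy => hy.sub (hpen y)) (h2.sub ?_)
      simpa using (hasDerivAt_id x).const_mul (2 * η)
    have e2 : 0 ≤ Dt - η * 3 := by
      refine leftDeriv_nonneg (f := E x) (h3.sub ?_).hasDerivWithinAt hloct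
      simpa using (((hasDerivAt_id t).const_mul 3).const_add (x ^ 2)).const_mul η
    linarith

/-! ### Differentiation of parametric integrals -/

/-- Differentiation of an integral over a fixed interval, for continuous data. -/
theorem hasDerivAt_integral_of_continuous {F F' : ℝ → ℝ → ℝ} {x r a b : ℝ} (hr : 0 < r)
    (hF : Continuous (fun p : ℝ × ℝ => F p.1 p.2)) (hF' : Continuous (fun p : ℝ × ℝ => F' p.1 p.2))
    (h : ∀ τ ∈ uIoc a b, ∀ y ∈ Metric.ball x r, HasDerivAt (fun y => F y τ) (F' y τ) y) :
    HasDerivAt (fun y => ∫ τ in a..b, F y τ) (∫ τ in a..b, F' x τ) x := by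
  have c1 : ∀ y, Continuous (F y) := fun y => hF.comp (by fun_prop : Continuous fun τ => (y, τ))
  have c2 : Continuous (F' x) := hF'.comp (by fun_prop : Continuous fun τ => (x, τ))
  obtain ⟨C, hC⟩ := ((isCompact_closedBall x r).prod
    (isCompact_uIcc (a := a) (b := b))).exists_bound_of_continuousOn hF'.continuousOn
  refine (intervalIntegral.hasDerivAt_integral_of_dominated_loc_of_deriv_le
    (bound := fun _ => C) (Metric.ball_mem_nhds x hr)
    (Eventually.of_forall fun y => (c1 y).aestronglyMeasurable) ((c1 x).intervalIntegrable _ _)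
    c2.aestronglyMeasurable (Eventually.of_forall fun τ hτ y hy => ?_)
    intervalIntegrable_const (Eventually.of_forall fun τ hτ y hy => h τ hτ y hy)).2
  exact hC (y, τ) ⟨Metric.ball_subset_closedBall hy, uIoc_subset_uIcc hτ⟩

/-- The Leibniz rule for an integral whose integrand and upper limit depend on the parameter. -/
theorem hasDerivAt_integral_upper {F F' : ℝ → ℝ → ℝ} {t r a : ℝ} (hr : 0 < r)
    (hF : Continuous (fun p : ℝ × ℝ => F p.1 p.2)) (hF' : Continuous (fun p : ℝ × ℝ => F' p.1 p.2))
    (h : ∀ τ ∈ uIoc a t, ∀ y ∈ Metric.ball t r, HasDerivAt (fun y => F y τ) (F' y τ) y) :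
    HasDerivAt (fun y => ∫ τ in a..y, F y τ) (F t t + ∫ τ in a..t, F' t τ) t := by
  have c1 : ∀ y, Continuous (F y) := fun y => hF.comp (by fun_prop : Continuous fun τ => (y, τ))
  have h1 := hasDerivAt_integral_of_continuous hr hF hF' h
  -- The short piece from `t` to `y` sees only values of `F` near the diagonal point `(t, t)`;
  -- continuity there suffices.
  have h2 : HasDerivAt (fun y => ∫ τ in t..y, F y τ) (F t t) t := by
    rw [hasDerivAt_iff_isLittleO, Asymptotics.isLittleO_iff]
    intro ε hε
    have hca : ContinuousAt (fun p : ℝ × ℝ => F p.1 p.2) (t, t) := hF.continuousAt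
    obtain ⟨δ, hδ, hball⟩ := Metric.continuousAt_iff.1 hca ε hε
    filter_upwards [Metric.ball_mem_nhds t hδ] with y hy
    have e : (∫ τ in t..y, F y τ) - (∫ τ in t..t, F t τ) - (y - t) • F t t
        = ∫ τ in t..y, (F y τ - F t t) := by
      rw [intervalIntegral.integral_sub ((c1 y).intervalIntegrable _ _) intervalIntegrable_const]
      simp
    rw [e]
    refine intervalIntegral.norm_integral_le_of_norm_le_const fun τ hτ => ?_
    have hτy : |τ - t| ≤ |y - t| := abs_sub_left_of_mem_uIcc (uIoc_subset_uIcc hτ)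
    have hy' : |y - t| < δ := by rwa [Metric.mem_ball, Real.dist_eq] at hy
    have := @hball (y, τ) (by
      rw [Prod.dist_eq, Real.dist_eq, Real.dist_eq]
      exact max_lt hy' (hτy.trans_lt hy'))
    rw [Real.dist_eq] at this
    exact this.le
  refine (h2.fun_add h1).congr_of_eventuallyEq (Eventually.of_forall fun y => ?_)
  dsimp only
  rw [add_comm, intervalIntegral.integral_add_adjacent_intervals ((c1 y).intervalIntegrable _ _)
    ((c1 y).intervalIntegrable _ _)]

/-! ### The heat kernel and its derivatives -/

/-- The heat kernel with mass one at time `σ`. -/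
noncomputable def gauss (y σ : ℝ) : ℝ := Real.exp (-y ^ 2 / (4 * σ)) / Real.sqrt (4 * Real.pi * σ)

/-- The factor by which the second space derivative of the heat kernel differs from it. -/
noncomputable def curvature (y σ : ℝ) : ℝ := y ^ 2 / (4 * σ ^ 2) - 1 / (2 * σ)

theorem gauss_nonneg (y σ : ℝ) : 0 ≤ gauss y σ := by unfold gauss; positivity

theorem gauss_le {y σ : ℝ} (hσ : 0 ≤ σ) : gauss y σ ≤ 1 / Real.sqrt (4 * Real.pi * σ) := by
  unfold gauss
  gcongr
  rw [Real.exp_le_one_iff, neg_div]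
  have : 0 ≤ y ^ 2 / (4 * σ) := by positivity
  linarith

theorem continuous_gauss {X : Type*} [TopologicalSpace X] {f ρ : X → ℝ} (hf : Continuous f)
    (hρ : Continuous ρ) (hpos : ∀ x, 0 < ρ x) : Continuous fun x => gauss (f x) (ρ x) := by
  unfold gauss
  refine Continuous.div (Real.continuous_exp.comp (Continuous.div (by fun_prop) (by fun_prop)
    fun x => ?_)) (by fun_prop) fun x => ?_
  · have := hpos x; positivity
  · have := hpos x; positivity

theorem hasDerivAt_gauss_space {σ : ℝ} (hσ : 0 < σ) (y : ℝ) :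
    HasDerivAt (fun y => gauss y σ) (-(y / (2 * σ)) * gauss y σ) y := by
  have h := (((hasDerivAt_pow 2 y).fun_neg.div_const (4 * σ)).exp).div_const
    (Real.sqrt (4 * Real.pi * σ))
  refine h.congr_deriv ?_
  unfold gauss
  push_cast
  field_simp
  ring

theorem hasDerivAt_gauss_space_deriv {σ : ℝ} (hσ : 0 < σ) (y : ℝ) :
    HasDerivAt (fun y => -(y / (2 * σ)) * gauss y σ)
      (curvature y σ * gauss y σ) y := by
  have h := ((hasDerivAt_id' y).div_const (2 * σ)).fun_neg.fun_mul (hasDerivAt_gauss_space hσ y)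
  refine h.congr_deriv ?_
  unfold curvature
  field_simp
  ring

/-- The factor is the one in `hasDerivAt_gauss_space_deriv`: together they are the heat equation. -/
theorem hasDerivAt_gauss_time {σ : ℝ} (hσ : 0 < σ) (y : ℝ) :
    HasDerivAt (gauss y) (curvature y σ * gauss y σ) σ := by
  have hq : 0 < 4 * Real.pi * σ := by positivity
  have hs := Real.sq_sqrt hq.le
  have hs0 := Real.sqrt_pos.2 hq
  have h1 := (hasDerivAt_const σ (-y ^ 2)).fun_div ((hasDerivAt_id' σ).const_mul 4)
    (by positivity)
  have h2 := ((hasDerivAt_id' σ).const_mul (4 * Real.pi)).sqrt (by simpa using hq.ne')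
  refine (h1.exp.fun_div h2 hs0.ne').congr_deriv ?_
  unfold gauss curvature
  set S := Real.sqrt (4 * Real.pi * σ)
  have hpi : Real.pi = S ^ 2 / (4 * σ) := by rw [hs]; field_simp
  rw [hpi]
  field_simp
  ring

/-! ### The potential of a smeared source on a curve -/

/-- The integrand of the potential of a Gaussian source of width `h` carried by the curve `s`. -/
noncomputable def layerIntegrand (γ h : ℝ) (s : ℝ → ℝ) (x t τ : ℝ) : ℝ :=
  Real.exp (-γ * (t - τ)) * gauss (x - s τ) (max (t - τ + h) (h / 2))

/-- The potential at time `t` of a Gaussian source of width `h` carried by the curve `s`. -/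
noncomputable def layer (γ h : ℝ) (s : ℝ → ℝ) (x t : ℝ) : ℝ :=
  ∫ τ in (0 : ℝ)..t, layerIntegrand γ h s x t τ

theorem layerIntegrand_self {γ h : ℝ} (hh : 0 < h) (s : ℝ → ℝ) (x t : ℝ) :
    layerIntegrand γ h s x t t = gauss (x - s t) h := by
  simp [layerIntegrand, hh.le]

section

variable {γ h : ℝ} {s : ℝ → ℝ}

/-- The cut-off at `h / 2` keeps the integrand continuous for all `τ`, even beyond `t + h`; for `τ ≤
t` it is inactive. -/
theorem width_pos (hh : 0 < h) (a : ℝ) : 0 < max a (h / 2) := lt_max_of_lt_right (by linarith)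

theorem continuous_layerIntegrand {X : Type*} [TopologicalSpace X] (hh : 0 < h)
    (hs : Continuous s) {a b c : X → ℝ} (ha : Continuous a) (hb : Continuous b)
    (hc : Continuous c) : Continuous fun p => layerIntegrand γ h s (a p) (b p) (c p) := by
  unfold layerIntegrand
  exact Continuous.mul (by fun_prop)
    (continuous_gauss (by fun_prop) (by fun_prop) fun p => width_pos hh _)

theorem continuous_layer (hh : 0 < h) (hs : Continuous s) :
    Continuous fun p : ℝ × ℝ => layer γ h s p.1 p.2 :=
  intervalIntegral.continuous_parametric_intervalIntegral_of_continuous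
    (f := fun (p : ℝ × ℝ) τ => layerIntegrand γ h s p.1 p.2 τ)
    (continuous_layerIntegrand hh hs (by fun_prop) (by fun_prop) (by fun_prop)) continuous_snd

theorem layer_nonneg {t : ℝ} (ht : 0 ≤ t) (x : ℝ) : 0 ≤ layer γ h s x t :=
  intervalIntegral.integral_nonneg ht fun _ _ =>
    mul_nonneg (Real.exp_nonneg _) (gauss_nonneg _ _)

theorem continuous_curvature {X : Type*} [TopologicalSpace X] {f ρ : X → ℝ} (hf : Continuous f)
    (hρ : Continuous ρ) (hpos : ∀ x, 0 < ρ x) : Continuous fun x => curvature (f x) (ρ x) := by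
  unfold curvature
  have h0 := fun x => (hpos x).ne'
  refine Continuous.sub (Continuous.div (by fun_prop) (by fun_prop) ?_)
    (Continuous.div (by fun_prop) (by fun_prop) ?_) <;> intro x <;> simp [h0 x]

/-- The potential of a Gaussian source carried by `s` solves the inhomogeneous equation. -/
theorem layer_hasDerivAt (hh : 0 < h) (hs : Continuous s) (x : ℝ) {t : ℝ} (ht : 0 < t) :
    ∃ (Wx : ℝ → ℝ) (Wxx : ℝ), (∀ y, HasDerivAt (fun y => layer γ h s y t) (Wx y) y) ∧
      HasDerivAt Wx Wxx x ∧
      HasDerivAt (layer γ h s x) (gauss (x - s t) h + (Wxx - γ * layer γ h s x t)) t := by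
  have hw := fun τ : ℝ => width_pos hh (t - τ + h)
  let F1 : ℝ → ℝ → ℝ := fun y τ =>
    -((y - s τ) / (2 * max (t - τ + h) (h / 2))) * layerIntegrand γ h s y t τ
  let F2 : ℝ → ℝ → ℝ := fun y τ =>
    curvature (y - s τ) (max (t - τ + h) (h / 2)) * layerIntegrand γ h s y t τ
  let F3 : ℝ → ℝ → ℝ := fun t τ =>
    (curvature (x - s τ) (max (t - τ + h) (h / 2)) - γ) * layerIntegrand γ h s x t τ
  have d1 : ∀ y τ, HasDerivAt (fun y => layerIntegrand γ h s y t τ) (F1 y τ) y := fun y τ =>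
    (((hasDerivAt_gauss_space (hw τ) (y - s τ)).comp_sub_const y (s τ)).const_mul _).congr_deriv
      (by simp only [F1, layerIntegrand]; ring)
  have d2 : ∀ y τ, HasDerivAt (fun y => F1 y τ) (F2 y τ) y := fun y τ => by
    have := ((hasDerivAt_gauss_space_deriv (hw τ) (y - s τ)).comp_sub_const y (s τ)).const_mul
      (Real.exp (-γ * (t - τ)))
    refine (this.congr_deriv ?_).congr_of_eventuallyEq (Eventually.of_forall fun z => ?_)
    · simp only [F2, layerIntegrand]; ring
    · simp only [F1, layerIntegrand]; ring
  have d3 : ∀ τ, ∀ y, τ - h / 2 < y →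
      HasDerivAt (fun y => layerIntegrand γ h s x y τ) (F3 y τ) y := fun τ y hy => by
    have hm : 0 < y - τ + h := by linarith
    have e1 : HasDerivAt (fun y => gauss (x - s τ) (y - τ + h))
        (curvature (x - s τ) (y - τ + h) * gauss (x - s τ) (y - τ + h)) y :=
      ((hasDerivAt_gauss_time hm (x - s τ)).comp_add_const (y - τ) h).comp_sub_const y τ
    have e2 : HasDerivAt (fun y => Real.exp (-γ * (y - τ))) (Real.exp (-γ * (y - τ)) * -γ) y :=
      (((hasDerivAt_id' y).sub_const τ).const_mul (-γ)).exp.congr_deriv (by ring)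
    have e3 : max (y - τ + h) (h / 2) = y - τ + h := max_eq_left (by linarith)
    refine ((e2.fun_mul e1).congr_deriv ?_).congr_of_eventuallyEq ?_
    · simp only [F3, layerIntegrand, e3]; ring
    · filter_upwards [Ioi_mem_nhds hy] with z hz
      have : max (z - τ + h) (h / 2) = z - τ + h := max_eq_left (by have := mem_Ioi.1 hz; linarith)
      simp only [layerIntegrand, this]
  have c0 : Continuous fun p : ℝ × ℝ => layerIntegrand γ h s p.1 t p.2 :=
    continuous_layerIntegrand hh hs (by fun_prop) (by fun_prop) (by fun_prop)
  have cd : Continuous fun p : ℝ × ℝ => -((p.1 - s p.2) / (2 * max (t - p.2 + h) (h / 2))) := by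
    refine Continuous.neg (Continuous.div (by fun_prop) (by fun_prop) fun p => ?_)
    have := hw p.2
    positivity
  have c1 : Continuous fun p : ℝ × ℝ => F1 p.1 p.2 := cd.mul c0
  have cd2 : Continuous fun p : ℝ × ℝ => curvature (p.1 - s p.2) (max (t - p.2 + h) (h / 2)) :=
    continuous_curvature (by fun_prop) (by fun_prop) fun p => hw p.2
  have c2 : Continuous fun p : ℝ × ℝ => F2 p.1 p.2 := cd2.mul c0
  have c3 : Continuous fun p : ℝ × ℝ => layerIntegrand γ h s x p.1 p.2 :=
    continuous_layerIntegrand hh hs (by fun_prop) (by fun_prop) (by fun_prop)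
  have cd3 : Continuous fun p : ℝ × ℝ =>
      curvature (x - s p.2) (max (p.1 - p.2 + h) (h / 2)) - γ :=
    (continuous_curvature (by fun_prop) (by fun_prop) fun p => width_pos hh _).sub
      continuous_const
  have c4 : Continuous fun p : ℝ × ℝ => F3 p.1 p.2 := cd3.mul c3
  have h1 : ∀ y, HasDerivAt (fun y => ∫ τ in (0 : ℝ)..t, layerIntegrand γ h s y t τ)
      (∫ τ in (0 : ℝ)..t, F1 y τ) y := fun y =>
    hasDerivAt_integral_of_continuous one_pos c0 c1 fun τ _ y _ => d1 y τ
  have h2 : HasDerivAt (fun y => ∫ τ in (0 : ℝ)..t, F1 y τ) (∫ τ in (0 : ℝ)..t, F2 x τ) x :=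
    hasDerivAt_integral_of_continuous one_pos c1 c2 fun τ _ y _ => d2 y τ
  refine ⟨_, _, h1, h2, ?_⟩
  have key : HasDerivAt (fun y => ∫ τ in (0 : ℝ)..y, layerIntegrand γ h s x y τ)
      (layerIntegrand γ h s x t t + ∫ τ in (0 : ℝ)..t, F3 t τ) t :=
    -- Within `h / 2` of `t` the cut-off stays inactive for every `τ ≤ t`, so the integrand is
    -- differentiable in time there.
    hasDerivAt_integral_upper (a := 0) (t := t) (half_pos hh) c3 c4 fun τ hτ y hy =>
    d3 τ y (by
      rw [uIoc_of_le ht.le] at hτ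
      rw [Metric.mem_ball, Real.dist_eq] at hy
      linarith [hτ.2, (abs_lt.1 hy).1])
  refine key.congr_deriv ?_
  rw [layerIntegrand_self hh, layer, ← intervalIntegral.integral_const_mul,
    ← intervalIntegral.integral_sub]
  · simp only [F3, F2, sub_mul]
  · exact (c2.comp (by fun_prop : Continuous fun τ : ℝ => (x, τ))).intervalIntegrable _ _
  · exact ((c0.comp (by fun_prop : Continuous fun τ : ℝ => (x, τ))).const_mul γ).intervalIntegrable
      _ _

/-- The potential is bounded by `1 / (2√γ)`, the integral over all times of the damped maximum of
the heat kernel. -/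
theorem layer_le (hγ : 0 < γ) (hh : 0 < h) (hs : Continuous s) (x : ℝ) {t : ℝ} (ht : 0 ≤ t) :
    layer γ h s x t ≤ 1 / (2 * Real.sqrt γ) := by
  let G : ℝ → ℝ := fun σ => σ ^ ((1 / 2 : ℝ) - 1) * Real.exp (-(γ * σ))
  have hpi := Real.sqrt_pos.2 Real.pi_pos
  have hI : ∫ σ in Ioi (0 : ℝ), G σ = Real.sqrt Real.pi / Real.sqrt γ := by
    rw [Real.integral_rpow_mul_exp_neg_mul_Ioi (by norm_num) hγ, Real.Gamma_one_half_eq,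
      ← Real.sqrt_eq_rpow, Real.sqrt_div zero_le_one, Real.sqrt_one]
    ring
  -- A non-integrable function would have integral 0 by convention, but the value found is positive.
  have hGi : IntegrableOn G (Ioi 0) := by
    by_contra hn
    rw [integral_undef hn] at hI
    have : 0 < Real.sqrt Real.pi / Real.sqrt γ := div_pos hpi (Real.sqrt_pos.2 hγ)
    linarith
  have hG0 : ∀ σ ∈ Ioi (0 : ℝ), 0 ≤ G σ := fun σ hσ =>
    mul_nonneg (Real.rpow_nonneg (le_of_lt hσ) _) (Real.exp_nonneg _)
  have hle : ∀ σ ∈ Ioc (0 : ℝ) t, layerIntegrand γ h s x t (t - σ)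
      ≤ 1 / (2 * Real.sqrt Real.pi) * G σ := fun σ hσ => by
    have h1 : gauss (x - s (t - σ)) (max (t - (t - σ) + h) (h / 2))
        ≤ 1 / (2 * Real.sqrt Real.pi) * σ ^ ((1 / 2 : ℝ) - 1) := by
      refine (gauss_le (width_pos hh _).le).trans ?_
      have e : σ ^ ((1 / 2 : ℝ) - 1) = 1 / Real.sqrt σ := by
        rw [Real.sqrt_eq_rpow, one_div (σ ^ _), ← Real.rpow_neg hσ.1.le]; norm_num
      have e2 : Real.sqrt (4 * Real.pi * σ) = 2 * Real.sqrt Real.pi * Real.sqrt σ := by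
        rw [Real.sqrt_mul (by positivity), Real.sqrt_mul (by norm_num),
          show (4 : ℝ) = 2 ^ 2 by norm_num, Real.sqrt_sq (by norm_num)]
      rw [e, one_div_mul_one_div, ← e2]
      have := Real.sqrt_pos.2 (show 0 < 4 * Real.pi * σ by have := hσ.1; positivity)
      gcongr
      -- The width is at least `σ`, so smearing only lowers the peak of the kernel.
      exact le_max_of_le_left (by linarith)
    have e3 : Real.exp (-γ * (t - (t - σ))) = Real.exp (-(γ * σ)) := by congr 1; ring
    rw [layerIntegrand, e3]
    calc _ ≤ Real.exp (-(γ * σ)) * (1 / (2 * Real.sqrt Real.pi) * σ ^ ((1 / 2 : ℝ) - 1)) := by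
          gcongr
      _ = _ := by simp only [G]; ring
  have hsub : layer γ h s x t = ∫ σ in (0 : ℝ)..t, layerIntegrand γ h s x t (t - σ) := by
    rw [intervalIntegral.integral_comp_sub_left (fun τ => layerIntegrand γ h s x t τ) t]
    simp [layer]
  have hci : Continuous fun σ => layerIntegrand γ h s x t (t - σ) :=
    continuous_layerIntegrand hh hs (by fun_prop) (by fun_prop) (by fun_prop)
  rw [hsub, intervalIntegral.integral_of_le ht]
  calc ∫ σ in Ioc 0 t, layerIntegrand γ h s x t (t - σ)
      ≤ ∫ σ in Ioc 0 t, 1 / (2 * Real.sqrt Real.pi) * G σ :=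
        setIntegral_mono_on (hci.integrableOn_Ioc)
          ((hGi.mono_set Ioc_subset_Ioi_self).const_mul _) measurableSet_Ioc hle
    _ = 1 / (2 * Real.sqrt Real.pi) * ∫ σ in Ioc 0 t, G σ := integral_const_mul _ _
    _ ≤ 1 / (2 * Real.sqrt Real.pi) * ∫ σ in Ioi 0, G σ := by
        gcongr
        · exact (ae_restrict_iff' measurableSet_Ioi).2 (Eventually.of_forall hG0)
        · exact Ioc_subset_Ioi_self
    _ = 1 / (2 * Real.sqrt γ) := by
        rw [hI]
        field_simp

end

/-! ### Gaussian tails and the corrector with a kink -/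

section

variable {h : ℝ}

theorem gauss_neg (y σ : ℝ) : gauss (-y) σ = gauss y σ := by simp [gauss]

theorem continuous_gauss_left (hh : 0 < h) : Continuous fun y => gauss y h :=
  continuous_gauss continuous_id continuous_const fun _ => hh

theorem gauss_eq (y h : ℝ) :
    gauss y h = (Real.sqrt (4 * Real.pi * h))⁻¹ * Real.exp (-(4 * h)⁻¹ * y ^ 2) := by
  rw [gauss, div_eq_mul_inv, mul_comm]
  congr 2
  ring

theorem integrable_gauss (hh : 0 < h) : Integrable fun y => gauss y h := by
  simp only [gauss_eq]
  exact (integrable_exp_neg_mul_sq (by positivity)).const_mul _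

theorem integral_gauss (hh : 0 < h) : ∫ y, gauss y h = 1 := by
  simp only [gauss_eq]
  rw [integral_const_mul, integral_gaussian, div_inv_eq_mul,
    show Real.pi * (4 * h) = 4 * Real.pi * h by ring]
  exact inv_mul_cancel₀ (Real.sqrt_pos.2 (by positivity)).ne'

theorem integral_gauss_Ioi (hh : 0 < h) : ∫ y in Ioi 0, gauss y h = 1 / 2 := by
  simp only [gauss_eq]
  rw [integral_const_mul, integral_gaussian_Ioi, div_inv_eq_mul,
    show Real.pi * (4 * h) = 4 * Real.pi * h by ring]
  have := Real.sqrt_pos.2 (show 0 < 4 * Real.pi * h by positivity)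
  field_simp

/-- The centred distribution function of the Gaussian kernel. -/
noncomputable def gaussPrimitive (h y : ℝ) : ℝ := ∫ z in (0 : ℝ)..y, gauss z h

theorem hasDerivAt_gaussPrimitive (hh : 0 < h) (y : ℝ) :
    HasDerivAt (gaussPrimitive h) (gauss y h) y :=
  intervalIntegral.integral_hasDerivAt_right ((continuous_gauss_left hh).intervalIntegrable _ _)
    ((continuous_gauss_left hh).stronglyMeasurableAtFilter _ _)
    (continuous_gauss_left hh).continuousAt

theorem gaussPrimitive_neg (h y : ℝ) : gaussPrimitive h (-y) = -gaussPrimitive h y := by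
  have := intervalIntegral.integral_comp_neg (a := 0) (b := y) fun z => gauss z h
  simp only [gauss_neg, neg_zero] at this
  rw [gaussPrimitive, gaussPrimitive, this, intervalIntegral.integral_symm]

theorem half_sub_gaussPrimitive (hh : 0 < h) (y : ℝ) :
    1 / 2 - gaussPrimitive h y = ∫ z in Ioi y, gauss z h := by
  rw [← integral_gauss_Ioi hh, gaussPrimitive, ← intervalIntegral.integral_interval_add_Ioi
    (integrable_gauss hh).integrableOn (integrable_gauss hh).integrableOn (a := 0) (b := y)]
  ring

theorem gaussPrimitive_le (hh : 0 < h) (y : ℝ) : gaussPrimitive h y ≤ 1 / 2 := by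
  have : 0 ≤ ∫ z in Ioi y, gauss z h := integral_nonneg fun z => gauss_nonneg z h
  linarith [half_sub_gaussPrimitive hh y]

/-- For `z ≥ y ≥ 0` one has `z² ≥ y² + (z - y)²`, so the tail is dominated by `gauss y h` times a
shifted Gaussian. The prefactor vanishes with `h`, which makes the motion of the kink affordable. -/
theorem half_sub_gaussPrimitive_le (hh : 0 < h) {y : ℝ} (hy : 0 ≤ y) :
    1 / 2 - gaussPrimitive h y ≤ Real.sqrt (4 * Real.pi * h) / 2 * gauss y h := by
  have hS := Real.sqrt_pos.2 (show 0 < 4 * Real.pi * h by positivity)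
  have hshift : ∫ z in Ioi y, gauss (z - y) h = 1 / 2 := by
    have := (measurePreserving_sub_right volume y).setIntegral_preimage_emb
      (measurableEmbedding_subRight y) (fun z => gauss z h) (Ioi 0)
    rw [integral_gauss_Ioi hh] at this
    simpa using this
  rw [half_sub_gaussPrimitive hh]
  calc ∫ z in Ioi y, gauss z h
      ≤ ∫ z in Ioi y, Real.sqrt (4 * Real.pi * h) * gauss y h * gauss (z - y) h := by
        refine setIntegral_mono_on (integrable_gauss hh).integrableOn
          (((integrable_gauss hh).comp_sub_right y).const_mul _).integrableOn measurableSet_Ioi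
          fun z hz => ?_
        have e : Real.sqrt (4 * Real.pi * h) * gauss y h * gauss (z - y) h
            = (Real.sqrt (4 * Real.pi * h))⁻¹ *
              Real.exp (-(4 * h)⁻¹ * y ^ 2 + -(4 * h)⁻¹ * (z - y) ^ 2) := by
          rw [gauss_eq y, gauss_eq (z - y), Real.exp_add]
          field_simp
        rw [e, gauss_eq z]
        gcongr
        rw [← mul_add, neg_mul, neg_mul, neg_le_neg_iff]
        gcongr
        nlinarith [mul_nonneg hy (sub_nonneg.2 (le_of_lt hz))]
    _ = _ := by rw [integral_const_mul, hshift]; ring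

/-- Replacing `z²` by its tangent `2yz - y²` at `y` bounds the tail by an explicit exponential
integral. The case `y = 0` is apart because the exponential then has no decay. The estimate is what
makes `kink` nonnegative. -/
theorem mul_half_sub_gaussPrimitive_le (hh : 0 < h) {y : ℝ} (hy : 0 ≤ y) :
    y * (1 / 2 - gaussPrimitive h y) ≤ 2 * h * gauss y h := by
  rcases hy.eq_or_lt with rfl | hy
  · have := gauss_nonneg 0 h
    rw [zero_mul]; positivity
  have ha : -(y / (2 * h)) < 0 := neg_lt_zero.2 (by positivity)
  have hS := Real.sqrt_pos.2 (show 0 < 4 * Real.pi * h by positivity)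
  set A := (Real.sqrt (4 * Real.pi * h))⁻¹ * Real.exp ((4 * h)⁻¹ * y ^ 2)
  have key : ∫ z in Ioi y, gauss z h ≤ ∫ z in Ioi y, A * Real.exp (-(y / (2 * h)) * z) := by
    refine setIntegral_mono_on (integrable_gauss hh).integrableOn
      ((integrableOn_exp_mul_Ioi ha y).const_mul _) measurableSet_Ioi fun z hz => ?_
    simp only [A]
    rw [gauss_eq z, mul_assoc (Real.sqrt _)⁻¹, ← Real.exp_add]
    gcongr
    have : (4 * h)⁻¹ * y ^ 2 + -(y / (2 * h)) * z - -(4 * h)⁻¹ * z ^ 2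
        = (4 * h)⁻¹ * (y - z) ^ 2 := by field_simp; ring
    have h0 : 0 ≤ (4 * h)⁻¹ * (y - z) ^ 2 := by positivity
    linarith
  have hg : A * Real.exp (-(y / (2 * h)) * y) = gauss y h := by
    simp only [A]
    rw [gauss_eq, mul_assoc (Real.sqrt _)⁻¹, ← Real.exp_add]
    congr 2
    field_simp
    ring
  rw [half_sub_gaussPrimitive hh]
  calc _ ≤ y * ∫ z in Ioi y, A * Real.exp (-(y / (2 * h)) * z) := by gcongr
    _ = 2 * h * gauss y h := by
      rw [integral_const_mul, integral_exp_mul_Ioi ha, ← hg]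
      field_simp

/-- A smooth function with second derivative the Gaussian kernel; it is asymptotic to `|y| / 2`. -/
noncomputable def smoothAbs (h y : ℝ) : ℝ := 2 * h * gauss y h + y * gaussPrimitive h y

theorem hasDerivAt_smoothAbs (hh : 0 < h) (y : ℝ) :
    HasDerivAt (smoothAbs h) (gaussPrimitive h y) y := by
  refine (((hasDerivAt_gauss_space hh y).const_mul (2 * h)).fun_add
    ((hasDerivAt_id' y).fun_mul (hasDerivAt_gaussPrimitive hh y))).congr_deriv ?_
  field_simp
  ring

theorem smoothAbs_neg (h y : ℝ) : smoothAbs h (-y) = smoothAbs h y := by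
  simp [smoothAbs, gauss_neg, gaussPrimitive_neg]

/-- A small nonnegative function with a kink of strength `-1` at the origin. -/
noncomputable def kink (h y : ℝ) : ℝ := smoothAbs h y - |y| / 2

theorem continuous_kink (hh : 0 < h) : Continuous (kink h) := by
  have : Continuous (smoothAbs h) :=
    continuous_iff_continuousAt.2 fun y => (hasDerivAt_smoothAbs hh y).continuousAt
  unfold kink
  fun_prop

theorem kink_abs (h y : ℝ) : kink h |y| = kink h y := by
  rcases abs_cases y with ⟨e, _⟩ | ⟨e, _⟩ <;> simp [kink, e, smoothAbs_neg]

theorem kink_of_nonneg {y : ℝ} (hy : 0 ≤ y) :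
    kink h y = 2 * h * gauss y h - y * (1 / 2 - gaussPrimitive h y) := by
  rw [kink, smoothAbs, abs_of_nonneg hy]
  ring

theorem kink_nonneg (hh : 0 < h) (y : ℝ) : 0 ≤ kink h y := by
  rw [← kink_abs, kink_of_nonneg (abs_nonneg y)]
  linarith [mul_half_sub_gaussPrimitive_le hh (abs_nonneg y)]

/-- On `y ≥ 0` the subtracted tail term is nonnegative, and the peak of the Gaussian bounds the
rest; the corrector thus disappears as `h → 0`. -/
theorem kink_le (hh : 0 < h) (y : ℝ) : kink h y ≤ Real.sqrt h := by
  rw [← kink_abs, kink_of_nonneg (abs_nonneg y)]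
  have h1 := mul_nonneg (abs_nonneg y) (sub_nonneg.2 (gaussPrimitive_le hh |y|))
  have h2 : 2 * h * gauss |y| h ≤ Real.sqrt h := by
    have hs := Real.sqrt_pos.2 hh
    have e : Real.sqrt (4 * h) = 2 * Real.sqrt h := by
      rw [Real.sqrt_mul (by norm_num), show (4 : ℝ) = 2 ^ 2 by norm_num, Real.sqrt_sq (by norm_num)]
    calc 2 * h * gauss |y| h ≤ 2 * h * (1 / Real.sqrt (4 * Real.pi * h)) := by
          gcongr; exact gauss_le hh.le
      _ ≤ 2 * h * (1 / Real.sqrt (4 * h)) := by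
          gcongr
          nlinarith [Real.pi_gt_three]
      _ = Real.sqrt h := by
          rw [e]
          field_simp
          exact (Real.sq_sqrt hh.le).symm
  linarith

/-- The derivative of `kink` off the origin. -/
noncomputable def kinkDeriv (h y : ℝ) : ℝ := gaussPrimitive h y - SignType.sign y / 2

theorem hasDerivAt_kink (hh : 0 < h) {y : ℝ} (hy : y ≠ 0) :
    HasDerivAt (kink h) (kinkDeriv h y) y :=
  (hasDerivAt_smoothAbs hh y).fun_sub ((hasDerivAt_abs hy).div_const 2)

theorem hasDerivAt_kinkDeriv (hh : 0 < h) {y : ℝ} (hy : y ≠ 0) :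
    HasDerivAt (kinkDeriv h) (gauss y h) y := by
  have e : (fun z : ℝ => ((SignType.sign z : ℝ)) / 2) =ᶠ[𝓝 y]
      fun _ => (SignType.sign y : ℝ) / 2 := by
    rcases hy.lt_or_gt with h0 | h0
    · filter_upwards [Iio_mem_nhds h0] with z hz
      rw [sign_neg h0, sign_neg hz]
    · filter_upwards [Ioi_mem_nhds h0] with z hz
      rw [sign_pos h0, sign_pos hz]
  exact ((hasDerivAt_gaussPrimitive hh y).fun_sub
    ((hasDerivAt_const y _).congr_of_eventuallyEq e)).congr_deriv (sub_zero _)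

theorem abs_kinkDeriv_le (hh : 0 < h) {y : ℝ} (hy : y ≠ 0) :
    |kinkDeriv h y| ≤ Real.sqrt (4 * Real.pi * h) / 2 * gauss y h := by
  rcases hy.lt_or_gt with h0 | h0
  · have h1 := half_sub_gaussPrimitive_le hh (neg_nonneg.2 h0.le)
    have h2 := gaussPrimitive_le hh (-y)
    rw [gaussPrimitive_neg, gauss_neg] at h1
    rw [gaussPrimitive_neg] at h2
    rw [kinkDeriv, sign_neg h0, abs_of_nonneg
      (by simp only [SignType.coe_neg, SignType.coe_one]; linarith)]
    simp only [SignType.coe_neg, SignType.coe_one]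
    linarith
  · have h1 := half_sub_gaussPrimitive_le hh h0.le
    have h2 := gaussPrimitive_le hh y
    rw [kinkDeriv, sign_pos h0, abs_of_nonpos (by simp only [SignType.coe_one]; linarith)]
    simp only [SignType.coe_one]
    linarith

/-- The smooth part has slope 0 at the origin, so the one-sided slopes come from `-|y| / 2` alone.
-/
theorem hasDerivWithinAt_kink_right (hh : 0 < h) :
    HasDerivWithinAt (kink h) (-(1 / 2)) (Ici 0) 0 := by
  have h1 := (hasDerivAt_smoothAbs hh 0).fun_sub ((hasDerivAt_id' (0 : ℝ)).div_const 2)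
  refine (h1.hasDerivWithinAt.congr_deriv (by simp [gaussPrimitive])).congr (fun y hy => ?_) ?_
  · simp [kink, abs_of_nonneg (mem_Ici.1 hy)]
  · simp [kink]

theorem hasDerivWithinAt_kink_left (hh : 0 < h) :
    HasDerivWithinAt (kink h) (1 / 2) (Iic 0) 0 := by
  have h1 := (hasDerivAt_smoothAbs hh 0).fun_add ((hasDerivAt_id' (0 : ℝ)).div_const 2)
  refine (h1.hasDerivWithinAt.congr_deriv (by simp [gaussPrimitive])).congr (fun y hy => ?_) ?_
  · simp only [kink, abs_of_nonpos (mem_Iic.1 hy)]; ring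
  · simp [kink]

end

/-! ### The initial-data part -/

theorem heatKernel_eq_gauss (x t ξ : ℝ) : heatKernel x t ξ 0 = gauss (x - ξ) t := by
  simp [heatKernel, gauss]

/-- Moving `x` from the kernel to the datum leaves a fixed integrable majorant, as dominated
convergence needs. -/
theorem integral_gauss_mul (f : ℝ → ℝ) (x t : ℝ) :
    ∫ ξ, gauss (x - ξ) t * f ξ = ∫ z, gauss z t * f (x - z) := by
  simpa using integral_sub_left_eq_self (fun z => gauss z t * f (x - z)) volume x

theorem continuous_integral_gauss_mul {t : ℝ} (ht : 0 < t) (f : ℝ →ᵇ ℝ) :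
    Continuous fun x => ∫ ξ, gauss (x - ξ) t * f ξ := by
  simp only [integral_gauss_mul]
  have hc := continuous_gauss_left ht
  refine continuous_of_dominated (bound := fun z => gauss z t * ‖f‖) (fun x => ?_)
    (fun x => Eventually.of_forall fun z => ?_) ((integrable_gauss ht).mul_const _)
    (Eventually.of_forall fun z => by fun_prop)
  · exact Continuous.aestronglyMeasurable (by fun_prop)
  · rw [norm_mul, Real.norm_of_nonneg (gauss_nonneg z t)]
    exact mul_le_mul_of_nonneg_left (f.norm_coe_le_norm _) (gauss_nonneg z t)

theorem norm_integral_gauss_mul_le {t : ℝ} (ht : 0 < t) (f : ℝ →ᵇ ℝ) (x : ℝ) :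
    ‖∫ ξ, gauss (x - ξ) t * f ξ‖ ≤ ‖f‖ := by
  rw [integral_gauss_mul]
  have := norm_integral_le_of_norm_le (f := fun z => gauss z t * f (x - z))
    ((integrable_gauss ht).mul_const ‖f‖)
    (Eventually.of_forall fun z => by
      rw [norm_mul, Real.norm_of_nonneg (gauss_nonneg z t)]
      exact mul_le_mul_of_nonneg_left (f.norm_coe_le_norm _) (gauss_nonneg z t))
  rwa [integral_mul_const, integral_gauss ht, one_mul] at this

/-- The initial-data part of the evolution is a bounded continuous function of norm at most
`exp (-γ t) N`, for data of norm at most `N`. -/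
theorem exists_initialPart (γ : ℝ) (v : ℝ → ℝ) {t N : ℝ} (ht : 0 ≤ t) (u₀ : ℝ →ᵇ ℝ)
    (hN : ‖u₀‖ ≤ N) : ∃ f : ℝ →ᵇ ℝ, (∀ x, f x = initialPart γ v t u₀ x) ∧
      ‖f‖ ≤ Real.exp (-γ * t) * N := by
  rcases ht.eq_or_lt with rfl | ht
  · exact ⟨u₀, fun x => by simp [initialPart], by simpa using hN⟩
  have he := Real.exp_pos (-γ * t)
  have e : ∀ x, initialPart γ v t u₀ x
      = Real.exp (-γ * t) * ∫ ξ, gauss (x + front v t - ξ) t * u₀ ξ := fun x => by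
    simp only [initialPart, if_neg ht.ne', heatKernel_eq_gauss]
  have hc : Continuous (initialPart γ v t u₀) := by
    rw [funext e]
    exact ((continuous_integral_gauss_mul ht u₀).comp
      (by fun_prop : Continuous fun x => x + front v t)).const_mul _
  have hb : ∀ x, ‖initialPart γ v t u₀ x‖ ≤ Real.exp (-γ * t) * N := fun x => by
    rw [e, norm_mul, Real.norm_of_nonneg he.le]
    exact mul_le_mul_of_nonneg_left ((norm_integral_gauss_mul_le ht u₀ _).trans hN) he.le
  exact ⟨BoundedContinuousFunction.ofNormedAddCommGroup _ hc _ hb, fun _ => rfl,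
    BoundedContinuousFunction.norm_ofNormedAddCommGroup_le hc
      (mul_nonneg he.le ((norm_nonneg _).trans hN)) hb⟩

/-! ### Comparison bounds for classical solutions -/

section

variable {g : ℝ → ℝ} {γ v₀ V₀ : ℝ} {u₀ : ℝ → ℝ} {u : ℝ → ℝ → ℝ} {v : ℝ → ℝ}

theorem IsKinetic.V₀_pos (hg : IsKinetic g v₀ V₀) : 0 < V₀ :=
  hg.v₀_pos.trans_le ((hg.lower 0 le_rfl).trans (hg.upper 0 le_rfl))

theorem IsClassicalSolution.velocity_mem (hu : IsClassicalSolution g γ u₀ u v)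
    (hg : IsKinetic g v₀ V₀) {t : ℝ} (ht : 0 < t) : -V₀ ≤ v t ∧ v t ≤ 0 := by
  have h0 := hu.front_nonneg t ht
  have h1 := hg.lower _ h0
  have h2 := hg.upper _ h0
  have := hg.v₀_pos
  rw [hu.kinetic t ht] at h1 h2
  constructor <;> linarith

theorem offFront_nhds_space {x t : ℝ} (ht : 0 < t) (hx : x ≠ front v t) :
    ∀ᶠ y in 𝓝 x, (y, t) ∈ offFront v :=
  (eventually_ne_nhds hx).mono fun _ hy => ⟨ht, hy⟩

theorem IsClassicalSolution.eventually_hasDerivAt (hu : IsClassicalSolution g γ u₀ u v) {x t : ℝ}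
    (ht : 0 < t) (hx : x ≠ front v t) :
    ∀ᶠ y in 𝓝 x, HasDerivAt (fun y => u y t) (deriv (fun y => u y t) y) y :=
  (offFront_nhds_space ht hx).mono fun y hy => (hu.differentiableAt_x (y, t) hy).hasDerivAt

/-- Classical solutions are nonnegative. -/
theorem IsClassicalSolution.nonneg (hu : IsClassicalSolution g γ u₀ u v) (hγ : 0 < γ) {x t : ℝ}
    (ht : 0 ≤ t) : 0 ≤ u x t := by
  obtain ⟨K, hK⟩ := hu.bounded t
  have := nonpos_of_subsolution (D := fun x t => -u x t) (s := front v) (T := t) (K := K)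
    hu.continuousOn_u.neg (fun x τ h0 h1 => (neg_le_abs _).trans (hK x τ h0 h1))
    (fun x => by rw [hu.initial]; linarith [hu.initial_nonneg x])
    (fun x τ hτ hx hpos => ?_) (fun τ hτ hpos => ?_) ht le_rfl (x₁ := x)
  · linarith
  · have hp : (x, τ) ∈ offFront v := ⟨hτ, hx⟩
    refine ⟨fun y => -deriv (fun y => u y τ) y, -deriv (u x) τ,
      -deriv (deriv fun y => u y τ) x,
      (hu.eventually_hasDerivAt hτ hx).mono fun y hy => hy.fun_neg,
      (hu.differentiableAt_xx _ hp).hasDerivAt.fun_neg,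
      (hu.differentiableAt_t _ hp).hasDerivAt.fun_neg, ?_⟩
    have h1 := hu.heat _ hp
    simp only at h1 hpos
    nlinarith
  -- No kink condition is needed: `-u` is never positive on the interface.
  · linarith [hu.front_nonneg τ hτ]

/-- The upper bound of classical solutions by a supersolution: the decaying maximum of the data,
the potential of a Gaussian source of width `h` on the interface, and a kink of size `√h`. -/
theorem IsClassicalSolution.le_barrier (hu : IsClassicalSolution g γ u₀ u v)
    (hg : IsKinetic g v₀ V₀) (hγ : 0 < γ) {N c h : ℝ} (hN : ∀ x, u₀ x ≤ N) (hN0 : 0 ≤ N)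
    (hc : V₀ < c) (hh : 0 < h) (x : ℝ) {t : ℝ} (ht : 0 ≤ t) :
    u x t ≤ N * Real.exp (-γ * t) + (c * (1 + V₀ * (Real.sqrt (4 * Real.pi * h) / 2))
      * (1 / (2 * Real.sqrt γ)) + c * Real.sqrt h) := by
  have hV := hg.V₀_pos
  have hc0 : 0 < c := hV.trans hc
  set κ := Real.sqrt (4 * Real.pi * h) / 2 with hκ
  have hκ0 : 0 ≤ κ := by positivity
  -- The share `c` of the source offsets the second derivative of the kink; the share `c * V₀ * κ`
  -- offsets the transport term arising because the kink moves at speed at most `V₀`.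
  set c' := c * (1 + V₀ * κ) with hc'
  have hc'0 : 0 ≤ c' := by positivity
  -- Extending `v` by `v 0` to negative times makes the curve differentiable everywhere without
  -- changing it for `τ ≥ 0`.
  let w : ℝ → ℝ := fun τ => v (max τ 0)
  have hw : Continuous w := hu.continuousOn_v.comp_continuous (by fun_prop) fun τ =>
    mem_Ici.2 (le_max_right _ _)
  let s : ℝ → ℝ := front w
  have hs' : ∀ τ, HasDerivAt s (w τ) τ := fun τ =>
    intervalIntegral.integral_hasDerivAt_right (hw.intervalIntegrable _ _)
      (hw.stronglyMeasurableAtFilter _ _) hw.continuousAt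
  have hs : Continuous s := continuous_iff_continuousAt.2 fun τ => (hs' τ).continuousAt
  have hsv : ∀ τ, 0 ≤ τ → s τ = front v τ := fun τ hτ =>
    intervalIntegral.integral_congr fun z hz => by
      rw [uIcc_of_le hτ] at hz
      simp only [w, max_eq_left hz.1]
  let W : ℝ → ℝ → ℝ := fun x τ => c' * layer γ h s x τ + c * kink h (x - s τ)
  have hWc : Continuous fun p : ℝ × ℝ => W p.1 p.2 :=
    ((continuous_layer hh hs).const_mul c').add
      (((continuous_kink hh).comp (by fun_prop : Continuous fun p : ℝ × ℝ => p.1 - s p.2)).const_mul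
        c)
  have hW0 : ∀ x τ, 0 ≤ τ → 0 ≤ W x τ := fun x τ hτ =>
    add_nonneg (mul_nonneg hc'0 (layer_nonneg hτ x)) (mul_nonneg hc0.le (kink_nonneg hh _))
  obtain ⟨K, hK⟩ := hu.bounded t
  have key := nonpos_of_subsolution (D := fun x τ => u x τ - W x τ - N * Real.exp (-γ * τ)) (s := s)
    (T := t) (K := K) ((hu.continuousOn_u.sub hWc.continuousOn).sub (by fun_prop))
    (fun x τ h0 h1 => ?_) (fun x => ?_) (fun x τ hτ hx hpos => ?_) (fun τ hτ hpos => ?_) ht le_rfl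
    (x₁ := x)
  · have h1 := mul_le_mul_of_nonneg_left (layer_le hγ hh hs x ht) hc'0
    have h2 := mul_le_mul_of_nonneg_left (kink_le hh (x - s t)) hc0.le
    simp only [W] at key
    linarith
  · have h2 := hW0 x τ h0
    have h3 := (le_abs_self _).trans (hK x τ h0 h1)
    have h4 : 0 ≤ N * Real.exp (-γ * τ) := by positivity
    linarith
  · have h2 := hW0 x 0 le_rfl
    have h3 := hN x
    rw [hu.initial]
    simp only [mul_zero, Real.exp_zero, mul_one]
    linarith
  · have hx' : x ≠ front v τ := hsv τ hτ.le ▸ hx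
    have hp : (x, τ) ∈ offFront v := ⟨hτ, hx'⟩
    obtain ⟨Wx, Wxx, w1, w2, w3⟩ := layer_hasDerivAt (γ := γ) hh hs x hτ
    have hy0 : x - s τ ≠ 0 := sub_ne_zero.2 hx
    have hev : ∀ᶠ y in 𝓝 x, y - s τ ≠ 0 :=
      (eventually_ne_nhds hx).mono fun _ hy => sub_ne_zero.2 hy
    have k1 : HasDerivAt (fun τ => kink h (x - s τ)) (kinkDeriv h (x - s τ) * -w τ) τ :=
      HasDerivAt.comp (h₂ := kink h) τ (hasDerivAt_kink hh hy0) ((hs' τ).const_sub x)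
    have k2 : HasDerivAt (fun τ => N * Real.exp (-γ * τ)) (N * (Real.exp (-γ * τ) * -γ)) τ :=
      (((hasDerivAt_id' τ).const_mul (-γ)).exp.congr_deriv (by ring)).const_mul N
    have d1 : ∀ᶠ y in 𝓝 x, HasDerivAt (fun y => u y τ - W y τ - N * Real.exp (-γ * τ))
        (deriv (fun y => u y τ) y - (c' * Wx y + c * kinkDeriv h (y - s τ))) y := by
      filter_upwards [hu.eventually_hasDerivAt hτ hx', hev] with y h1 h2
      exact (h1.fun_sub (((w1 y).const_mul c').fun_add
        (((hasDerivAt_kink hh h2).comp_sub_const y (s τ)).const_mul c))).sub_const _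
    have d2 : HasDerivAt
        (fun y => deriv (fun y => u y τ) y - (c' * Wx y + c * kinkDeriv h (y - s τ)))
        (deriv (deriv fun y => u y τ) x - (c' * Wxx + c * gauss (x - s τ) h)) x :=
      (hu.differentiableAt_xx _ hp).hasDerivAt.fun_sub ((w2.const_mul c').fun_add
        (((hasDerivAt_kinkDeriv hh hy0).comp_sub_const x (s τ)).const_mul c))
    have d3 := ((hu.differentiableAt_t _ hp).hasDerivAt.fun_sub ((w3.const_mul c').fun_add
      (k1.const_mul c))).fun_sub k2
    refine ⟨_, _, _, d1, d2, d3, ?_⟩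
    have h1 := hu.heat _ hp
    simp only [W] at h1 hpos
    rw [h1]
    have hwτ : |w τ| ≤ V₀ := by
      have := hu.velocity_mem hg hτ
      simp only [w, max_eq_left hτ.le]
      rw [abs_of_nonpos this.2]
      linarith
    have h2 : kinkDeriv h (x - s τ) * w τ ≤ V₀ * κ * gauss (x - s τ) h := by
      refine (le_abs_self _).trans ?_
      rw [abs_mul, mul_assoc, mul_comm]
      exact mul_le_mul hwτ (abs_kinkDeriv_le hh hy0) (abs_nonneg _) hV.le
    have h3 := mul_le_mul_of_nonneg_left h2 hc0.le
    have h4 := mul_nonneg (mul_nonneg hγ.le hc0.le) (kink_nonneg hh (x - s τ))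
    -- Where the difference is positive, its damping term has the favourable sign.
    have h5 := mul_pos hγ hpos
    have h6 : c' * gauss (x - s τ) h
        = c * gauss (x - s τ) h + c * (V₀ * κ * gauss (x - s τ) h) := by rw [hc']; ring
    linarith
  · obtain ⟨a, b, ha, hb, hab⟩ := hu.jump τ hτ
    rw [← hsv τ hτ.le] at ha hb
    obtain ⟨Wx, Wxx, w1, w2, w3⟩ := layer_hasDerivAt (γ := γ) hh hs (s τ) hτ
    have hsub : ∀ S : Set ℝ, HasDerivWithinAt (fun y => y - s τ) 1 S (s τ) := fun S =>
      ((hasDerivAt_id' _).sub_const _).hasDerivWithinAt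
    have kr : HasDerivWithinAt (fun y => kink h (y - s τ)) (-(1 / 2) * 1) (Ici (s τ)) (s τ) :=
      HasDerivWithinAt.comp (h₂ := kink h) (s τ)
        (by rw [sub_self]; exact hasDerivWithinAt_kink_right hh) (hsub _)
        fun y hy => mem_Ici.2 (sub_nonneg.2 hy)
    have kl : HasDerivWithinAt (fun y => kink h (y - s τ)) (1 / 2 * 1) (Iic (s τ)) (s τ) :=
      HasDerivWithinAt.comp (h₂ := kink h) (s τ)
        (by rw [sub_self]; exact hasDerivWithinAt_kink_left hh) (hsub _)
        fun y hy => mem_Iic.2 (sub_nonpos.2 hy)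
    -- The layer is smooth and cancels from the jump, which is `v τ + c ≥ c - V₀ > 0`.
    refine ⟨_, _, (ha.fun_sub (((w1 (s τ)).hasDerivWithinAt.const_mul c').fun_add
        (kr.const_mul c))).sub_const _, (hb.fun_sub
        (((w1 (s τ)).hasDerivWithinAt.const_mul c').fun_add (kl.const_mul c))).sub_const _, ?_⟩
    have := (hu.velocity_mem hg hτ).1
    linarith

/-- The upper bound of classical solutions in the limit of a vanishing width of the source. -/
theorem IsClassicalSolution.le_add (hu : IsClassicalSolution g γ u₀ u v)
    (hg : IsKinetic g v₀ V₀) (hγ : 0 < γ) {N : ℝ} (hN : ∀ x, u₀ x ≤ N) (hN0 : 0 ≤ N) (x : ℝ)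
    {t : ℝ} (ht : 0 ≤ t) :
    u x t ≤ N * Real.exp (-γ * t) + V₀ / (2 * Real.sqrt γ) := by
  -- One parameter drives both limits: width `h = r` and strength `c = V₀ + r`, the excess keeping
  -- the kink strict.
  let B : ℝ → ℝ := fun r => N * Real.exp (-γ * t) +
    ((V₀ + r) * (1 + V₀ * (Real.sqrt (4 * Real.pi * r) / 2)) * (1 / (2 * Real.sqrt γ))
      + (V₀ + r) * Real.sqrt r)
  have hB : Continuous B := by fun_prop
  have hlim : Tendsto B (𝓝[>] 0) (𝓝 (B 0)) := hB.continuousAt.tendsto.mono_left nhdsWithin_le_nhds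
  have hB0 : B 0 = N * Real.exp (-γ * t) + V₀ / (2 * Real.sqrt γ) := by
    simp [B, div_eq_mul_inv]
  rw [← hB0]
  refine ge_of_tendsto hlim ?_
  filter_upwards [self_mem_nhdsWithin] with r hr
  exact hu.le_barrier hg hγ hN hN0 (lt_add_of_pos_right V₀ hr) hr x ht

end

/-! ### Absorption of bounded sets -/

/-- The ball of radius `V₀ / (2√γ) + ε` absorbs all bounded sets. -/
theorem isAbsorbing_ball {g : ℝ → ℝ} {v₀ V₀ γ : ℝ} (hg : IsKinetic g v₀ V₀) (hγ : 0 < γ) {ε : ℝ}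
    (hε : 0 < ε) : IsAbsorbing g γ {w : ℝ →ᵇ ℝ | ‖w‖ ≤ V₀ / (2 * Real.sqrt γ) + ε} := by
  intro B hB
  obtain ⟨N, hNpos, hN⟩ := hB.exists_pos_norm_le
  have hlim : Tendsto (fun t => N * Real.exp (-γ * t)) atTop (𝓝 0) := by
    have h1 : Tendsto (fun t => -γ * t) atTop atBot :=
      tendsto_id.const_mul_atTop_of_neg (neg_lt_zero.2 hγ)
    simpa using (Real.tendsto_exp_atBot.comp h1).const_mul N
  obtain ⟨t₀, ht₀⟩ := eventually_atTop.1 (hlim.eventually_le_const hε)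
  refine ⟨max t₀ 0, le_max_right _ _, fun t ht w hw => ?_⟩
  obtain ⟨u₀, hu₀, u, v, hu, hwu⟩ := hw
  have ht0 : 0 ≤ t := (le_max_right _ _).trans ht
  have hdecay := ht₀ t ((le_max_left _ _).trans ht)
  have hV := hg.V₀_pos
  refine (BoundedContinuousFunction.norm_le (by positivity)).2 fun x => ?_
  rw [hwu, Real.norm_of_nonneg (hu.nonneg hγ ht0)]
  have := hu.le_add hg hγ
    (fun x => (le_abs_self _).trans ((u₀.norm_coe_le_norm x).trans (hN u₀ hu₀))) hNpos.le
    (x + front v t) ht0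
  linarith

end StefanKinetics

theorem mainTheorem6 (g : ℝ → ℝ) (v₀ V₀ γ : ℝ) (hg : StefanKinetics.IsKinetic g v₀ V₀)
    (hγ : 0 < γ) :
    (∀ (N : ℝ) (u₀ : ℝ →ᵇ ℝ), ‖u₀‖ ≤ N →
      ∀ (u : ℝ → ℝ → ℝ) (v : ℝ → ℝ), StefanKinetics.IsClassicalSolution g γ u₀ u v →
        ∀ t : ℝ, 0 ≤ t → ∃ f : ℝ →ᵇ ℝ,
          (∀ x, f x = StefanKinetics.initialPart γ v t u₀ x) ∧
            ‖f‖ ≤ Real.exp (-γ * t) * N) ∧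
    (∀ ε : ℝ, 0 < ε →
      StefanKinetics.IsAbsorbing g γ {w : ℝ →ᵇ ℝ | ‖w‖ ≤ V₀ / (2 * Real.sqrt γ) + ε}) :=
  ⟨fun _ u₀ hN _ v _ _ ht => StefanKinetics.exists_initialPart γ v ht u₀ hN,
    fun _ hε => StefanKinetics.isAbsorbing_ball hg hγ hε⟩
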